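/- Setting. For a distribution $\mathcal D$ on $\mathbb R^d\times\mathbb R$ let $L_{\mathcal D}(w)=\mathbf E_{(x,y)\sim\mathcal D}\big[\tfrac12(w^\top x-y)^2\big]$. A regression algorithm with limited attribute observation (LAO) and attribute budget $k$ has access to a sequence of i.i.d. examples $(x_t,y_t)\sim\mathcal D$; using internal randomness, it adaptively chooses single attributes $x_t[i]$ or labels $y_t$ to observe, in any order, observing at most $k$ distinct attributes of each example $x_t$, until it stops (if ever) and returns a regressor $w\in\mathbb R^d$. An example is seen if its label or at least one of its attributes is observed. For a reference regressor $w_\star$, the algorithm $\varepsilon$-learns $\mathcal D$ if, with probability at least $2/3$ over its randomness and the examples, it stops and returns $w$ with $\|w\|_2\le 1$ and $L_{\mathcal D}(w)-L_{\mathcal D}(w_\star)\le\varepsilon$. For $T\subseteq\{1,\dots,d\}$ with $|T|=K\ge1$ and signs $r\in\{\pm1\}^d$, let $\mathcal D_{T,r}$ be the uniform distribution on the $K$ examples $(r_i\mathbf e_i,1)$, $i\in T$, and let $w_\star^{T,r}=\sum_{i\in T}K^{-1/2}r_i\mathbf e_i$. Theorem (lower bound for LAO Ridge regression). For every $a>0$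 there is a constant $c>0$, depending only on $a$, such that for all integers $d,k\ge1$ and all real $\varepsilon$ with $a/\sqrt d\le\varepsilon<\tfrac12$ there is an integer $K$ with $1\le K\le d$ and $c/\varepsilon^2\le K\le1/\varepsilon^2$ for which the following two statements hold for every LAO regression algorithm with attribute budget $k$. (1) There are $T$ with $|T|=K$ and signs $r$ such that for $\mathcal D=\mathcal D_{T,r}$ and $w_\star=w_\star^{T,r}$: the distribution $\mathcal D$ is supported on $\{\|x\|_2\le1\}\times\{1\}$, $w_\star$ minimizes $L_{\mathcal D}$ over $\{\|w\|_2\le1\}$, and if the algorithm $\varepsilon$-learns $\mathcal D$, then on $\mathcal D$ it observes in expectation at least $c\,\dfrac{d}{\varepsilon^2}$ attributes and sees in expectation at least $c\,\dfrac{d}{k\varepsilon^2}$ examples. (2) Let $T$ be a uniformly random $K$-element subset of $\{1,\dots,d\}$ and let $r$ be independent uniformly random signs. If, with probability at least $2/3$ over $(T,r)$, the examples drawn from $\mathcal D_{T,r}$ and the internal randomness, the algorithm stops and returns $w$ with $\|w\|_2\le1$ and $L_{\mathcal D_{T,r}}(w)-L_{\mathcal D_{T,r}}(w_\star^{T,r})\le\varepsilon$,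 then in expectation (over all of this) it observes at least $c\,\dfrac{d}{\varepsilon^2}$ attributes and sees at least $c\,\dfrac{d}{k\varepsilon^2}$ examples. -/

import Mathlib

open MeasureTheory
open scoped ENNReal

/-- An example `(x, y)`: an attribute vector `x ∈ ℝᵈ` (Euclidean norm) and a target `y ∈ ℝ`. -/
abbrev LabeledExample (d : ℕ) : Type := EuclideanSpace ℝ (Fin d) × ℝ

/-- What a learner can look at: `Sum.inl (t, i)` is attribute `i` of the `t`-th training example,
`Sum.inr t` is the label of the `t`-th training example. -/
abbrev Observation (d : ℕ) : Type := (ℕ × Fin d) ⊕ ℕ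

/-- The value shown to the learner when it makes an observation on the training sequence `z`. -/
def reveal {d : ℕ} (z : ℕ → LabeledExample d) : Observation d → ℝ
  | Sum.inl (t, i) => (z t).1 i
  | Sum.inr t => (z t).2

/-- The index of the training example that an observation looks at. -/
def exampleIndex {d : ℕ} : Observation d → ℕ
  | Sum.inl (t, _) => t
  | Sum.inr t => t

/-- A randomized, fully adaptive algorithm for regression from limited observations, with internal
randomness in `Ω`. Having seen `n` values so far, it decides (measurably, from its randomness and
these values) either to make one more observation, `Sum.inl o`, or to stop and return the
regressor `w`, `Sum.inr w`. (The earlier observations are determined by the randomness and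
the earlier values.) Examples may be visited in any order and revisited. -/
structure LAOAlgorithm (d : ℕ) (Ω : Type*) [MeasurableSpace Ω] where
  act : (n : ℕ) → Ω → (Fin n → ℝ) → Observation d ⊕ EuclideanSpace ℝ (Fin d)
  measurable_act : ∀ n, Measurable fun p : Ω × (Fin n → ℝ) => act n p.1 p.2

namespace LAOAlgorithm

variable {d : ℕ} {Ω : Type*} [MeasurableSpace Ω]

/-- The first `n` values seen by the algorithm with randomness `ω` on the training sequence `z`.
After the algorithm has stopped the transcript is padded with zeros, which are never used. -/
noncomputable def transcript (A : LAOAlgorithm d Ω) (ω : Ω) (z : ℕ → LabeledExample d) :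
    (n : ℕ) → (Fin n → ℝ)
  | 0 => Fin.elim0
  | n + 1 => Fin.snoc (α := fun _ => ℝ) (A.transcript ω z n)
      (Sum.elim (reveal z) (fun _ => 0) (A.act n ω (A.transcript ω z n)))

/-- The decision of the algorithm at step `n` (meaningful if it has not stopped before). -/
noncomputable def decision (A : LAOAlgorithm d Ω) (ω : Ω) (z : ℕ → LabeledExample d) (n : ℕ) :
    Observation d ⊕ EuclideanSpace ℝ (Fin d) :=
  A.act n ω (A.transcript ω z n)

/-- The algorithm has made no stopping decision before step `n`. -/
def RunningAt (A : LAOAlgorithm d Ω) (ω : Ω) (z : ℕ → LabeledExample d) (n : ℕ) : Prop :=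
  ∀ m < n, ∃ o, A.decision ω z m = Sum.inl o

/-- The set of all observations made in the run. -/
def observations (A : LAOAlgorithm d Ω) (ω : Ω) (z : ℕ → LabeledExample d) :
    Set (Observation d) :=
  {o | ∃ n, A.RunningAt ω z n ∧ A.decision ω z n = Sum.inl o}

/-- The run stops and returns `w`. -/
def Returns (A : LAOAlgorithm d Ω) (ω : Ω) (z : ℕ → LabeledExample d)
    (w : EuclideanSpace ℝ (Fin d)) : Prop :=
  ∃ n, A.RunningAt ω z n ∧ A.decision ω z n = Sum.inr w

/-- The attributes observed in the run, as pairs (example, coordinate). -/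
def attributesSeen (A : LAOAlgorithm d Ω) (ω : Ω) (z : ℕ → LabeledExample d) :
    Set (ℕ × Fin d) :=
  {q | Sum.inl q ∈ A.observations ω z}

/-- The training examples seen in the run: those of which the label or some attribute has been
observed. -/
def examplesSeen (A : LAOAlgorithm d Ω) (ω : Ω) (z : ℕ → LabeledExample d) : Set ℕ :=
  exampleIndex '' A.observations ω z

/-- The algorithm accesses at most `k` attributes of each training example. -/
def AttributeBudget (A : LAOAlgorithm d Ω) (k : ℕ) : Prop :=
  ∀ (ω : Ω) (z : ℕ → LabeledExample d) (t : ℕ),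
    {i : Fin d | (t, i) ∈ A.attributesSeen ω z}.ncard ≤ k

end LAOAlgorithm

/-- The expected squared loss `L_D(w) = E_{(x,y) ∼ D} [½ (wᵀx - y)²]`. -/
noncomputable def risk {d : ℕ} (D : Measure (LabeledExample d))
    (w : EuclideanSpace ℝ (Fin d)) : ℝ :=
  ∫ z, (1 / 2 : ℝ) * (inner ℝ w z.1 - z.2) ^ 2 ∂D

/-- The joint law of the internal randomness `ω ∼ ρ` and an independent training sequence of
independent examples, each distributed according to `D`. -/
noncomputable def runLaw {d : ℕ} {Ω : Type*} [MeasurableSpace Ω] (ρ : Measure Ω)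
    (D : Measure (LabeledExample d)) : Measure (Ω × (ℕ → LabeledExample d)) :=
  ρ.prod (Measure.infinitePi fun _ : ℕ => D)

namespace LAOAlgorithm

variable {d : ℕ} {Ω : Type*} [MeasurableSpace Ω]

/-- The probability that the algorithm stops with a regressor `w` in the Euclidean unit ball such
that `L_D(w) - L_D(wstar) ≤ ε`. -/
noncomputable def successProb (A : LAOAlgorithm d Ω) (ρ : Measure Ω)
    (D : Measure (LabeledExample d)) (wstar : EuclideanSpace ℝ (Fin d)) (ε : ℝ) : ℝ≥0∞ :=
  runLaw ρ D {p | ∃ w, A.Returns p.1 p.2 w ∧ ‖w‖ ≤ 1 ∧ risk D w - risk D wstar ≤ ε}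

/-- The expected number of (distinct) attributes observed. -/
noncomputable def expectedAttributes (A : LAOAlgorithm d Ω) (ρ : Measure Ω)
    (D : Measure (LabeledExample d)) : ℝ≥0∞ :=
  ∫⁻ p, ((A.attributesSeen p.1 p.2).encard : ℝ≥0∞) ∂(runLaw ρ D)

/-- The expected number of (distinct) training examples seen. -/
noncomputable def expectedExamples (A : LAOAlgorithm d Ω) (ρ : Measure Ω)
    (D : Measure (LabeledExample d)) : ℝ≥0∞ :=
  ∫⁻ p, ((A.examplesSeen p.1 p.2).encard : ℝ≥0∞) ∂(runLaw ρ D)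

end LAOAlgorithm

/-- The hard distribution with support set `T ⊆ [d]` and signs `r`: the uniform distribution on the
examples `(r i • e_i, 1)`, `i ∈ T`. -/
noncomputable def hardDistribution {d : ℕ} (T : Finset (Fin d)) (r : Fin d → ℤˣ) :
    Measure (LabeledExample d) :=
  (T.card : ℝ≥0∞)⁻¹ •
    ∑ i ∈ T, Measure.dirac (EuclideanSpace.single i (((r i : ℤ) : ℝ)), (1 : ℝ))

/-- The regressor `∑_{i ∈ T} |T|^{-1/2} r_i e_i`. -/
noncomputable def hardRegressor {d : ℕ} (T : Finset (Fin d)) (r : Fin d → ℤˣ) :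
    EuclideanSpace ℝ (Fin d) :=
  ∑ i ∈ T, EuclideanSpace.single i (((r i : ℤ) : ℝ) / Real.sqrt T.card)

/-- The average of `f T r` over a uniformly random set `T ⊆ [d]` with `K` elements and independent
uniformly random signs `r i`. -/
noncomputable def hardAverage (d K : ℕ) (f : Finset (Fin d) → (Fin d → ℤˣ) → ℝ≥0∞) : ℝ≥0∞ :=
  (∑ T ∈ Finset.powersetCard K (Finset.univ : Finset (Fin d)), ∑ r : Fin d → ℤˣ, f T r) /
    ((d.choose K * 2 ^ d : ℕ) : ℝ≥0∞)

/-! Write the support of the hard distribution as the image of an injection `s : Fin K ↪ Fin d`, and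
draw an example by drawing a hidden index `j`. It then has a single nonzero attribute, at `s j`,
with sign `r (s j)`; its label is always 1 and carries no information. Once the internal randomness
`ω` and the index sequence `J` are fixed, a run is a deterministic function of `(s, r)`, so
everything reduces to finite counting over `(s, r)`.

Success needs discoveries. A successful regressor has correlation at least `3/4 * √K` with the signs
on the support. Flipping the sign of a direction never probed on its own examples does not change
the run, so undiscovered directions contribute zero on average (`sum_undiscovered_eq_zero`). By
Cauchy–Schwarz, `n` discovered directions contribute at most `√n`. Hence success with probability
2/3 forces an average number of discoveries of order `K` (`success_le_discovered`).

Discoveries are expensive. If `s j` is discovered and `i` is another possible position for it, then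
either this run probes `i` on examples of index `j`, or the run with the hidden value moved to `i`
probes `s j` there (`probed_of_discovered`). Double counting charges each discovery about `d / 2`
probes (`discovered_le_probed`).

Together the average number of attributes is at least of order `K * d`, with `K` of order `1 / ε ^
2`. The budget `k` enters only when attributes are converted into examples. -/

namespace LAOAlgorithm

variable {d : ℕ} {Ω : Type*} [MeasurableSpace Ω]

/-! ### Comparing two runs -/

lemma RunningAt.mono {A : LAOAlgorithm d Ω} {ω : Ω} {z : ℕ → LabeledExample d} {m n : ℕ}
    (h : A.RunningAt ω z n) (hmn : m ≤ n) : A.RunningAt ω z m :=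
  fun l hl => h l (hl.trans_le hmn)

/-- Agreement is needed only on observations made by both runs: until the first differing answer the
runs coincide, so the observation giving that answer belongs to both. This symmetric hypothesis is
what the exchange argument in `probed_of_discovered` uses. -/
lemma RunningAt.congr {A : LAOAlgorithm d Ω} {ω : Ω} {z z' : ℕ → LabeledExample d}
    (h : ∀ o ∈ A.observations ω z, o ∈ A.observations ω z' → reveal z o = reveal z' o) (n : ℕ)
    (hn : A.RunningAt ω z n) :
    A.RunningAt ω z' n ∧ A.transcript ω z n = A.transcript ω z' n := by
  induction n with
  | zero => exact ⟨fun m hm => absurd hm (Nat.not_lt_zero m), rfl⟩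
  | succ n ih =>
    obtain ⟨hr, ht⟩ := ih (hn.mono n.le_succ)
    obtain ⟨o, ho⟩ := hn n n.lt_succ_self
    have ho' : A.decision ω z' n = Sum.inl o := by
      rw [← ho]; simp only [decision, ht]
    refine ⟨fun m hm => ?_, ?_⟩
    · rcases Nat.lt_succ_iff_lt_or_eq.mp hm with hm | rfl
      · exact hr m hm
      · exact ⟨o, ho'⟩
    · have key := h o ⟨n, hn.mono n.le_succ, ho⟩ ⟨n, hr, ho'⟩
      simp only [decision] at ho'
      simp only [transcript, ho', Sum.elim_inl, key, ht]

lemma observations_subset_of_reveal_eq {A : LAOAlgorithm d Ω} {ω : Ω}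
    {z z' : ℕ → LabeledExample d}
    (h : ∀ o ∈ A.observations ω z, o ∈ A.observations ω z' → reveal z o = reveal z' o) :
    A.observations ω z ⊆ A.observations ω z' := by
  rintro o ⟨n, hn, ho⟩
  obtain ⟨hr, ht⟩ := hn.congr h
  exact ⟨n, hr, by rw [← ho]; simp only [decision, ht]⟩

lemma Returns.congr {A : LAOAlgorithm d Ω} {ω : Ω} {z z' : ℕ → LabeledExample d}
    {w : EuclideanSpace ℝ (Fin d)}
    (h : ∀ o ∈ A.observations ω z, o ∈ A.observations ω z' → reveal z o = reveal z' o)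
    (hw : A.Returns ω z w) : A.Returns ω z' w := by
  obtain ⟨n, hn, ho⟩ := hw
  obtain ⟨hr, ht⟩ := hn.congr h
  exact ⟨n, hr, by rw [← ho]; simp only [decision, ht]⟩

lemma Returns.unique {A : LAOAlgorithm d Ω} {ω : Ω} {z : ℕ → LabeledExample d}
    {w w' : EuclideanSpace ℝ (Fin d)} (h : A.Returns ω z w) (h' : A.Returns ω z w') : w = w' := by
  obtain ⟨n, hn, hw⟩ := h
  obtain ⟨n', hn', hw'⟩ := h'
  rcases lt_trichotomy n n' with hlt | rfl | hlt
  · obtain ⟨o, ho⟩ := hn' n hlt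
    simp [hw] at ho
  · simpa [hw] using hw'
  · obtain ⟨o, ho⟩ := hn n' hlt
    simp [hw'] at ho

/-! ### Measurability of the run -/

lemma measurable_reveal (o : Observation d) :
    Measurable fun z : ℕ → LabeledExample d => reveal z o := by
  rcases o with ⟨t, i⟩ | t
  · simp only [reveal]; fun_prop
  · simp only [reveal]; fun_prop

lemma measurableSet_singleton_observation (o : Observation d) : MeasurableSet {o} := by
  rcases o with q | t
  · rw [← Set.image_singleton]; exact (measurableSet_singleton q).inl_image
  · rw [← Set.image_singleton]; exact (measurableSet_singleton t).inr_image

lemma measurable_transcript (A : LAOAlgorithm d Ω) (n : ℕ) :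
    Measurable fun p : Ω × (ℕ → LabeledExample d) => A.transcript p.1 p.2 n := by
  induction n with
  | zero => exact measurable_const
  | succ n ih =>
    have hact : Measurable fun p : Ω × (ℕ → LabeledExample d) =>
        A.act n p.1 (A.transcript p.1 p.2 n) :=
      (A.measurable_act n).comp (measurable_fst.prodMk ih)
    refine measurable_pi_iff.mpr fun i => ?_
    refine Fin.lastCases ?_ (fun j => ?_) i
    · simp only [transcript, Fin.snoc_last]
      intro B hB
      -- The observation is itself random, but there are only countably many, so the event splits
      -- according to its value.
      have : (fun p : Ω × (ℕ → LabeledExample d) =>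
          Sum.elim (reveal p.2) (fun _ => (0 : ℝ)) (A.act n p.1 (A.transcript p.1 p.2 n))) ⁻¹' B =
          (⋃ o : Observation d, {p | A.act n p.1 (A.transcript p.1 p.2 n) ∈ Sum.inl '' {o}} ∩
            {p | reveal p.2 o ∈ B}) ∪
          ({p | A.act n p.1 (A.transcript p.1 p.2 n) ∈ Set.range Sum.inr} ∩
            {_p | (0 : ℝ) ∈ B}) := by
        ext p
        rcases h : A.act n p.1 (A.transcript p.1 p.2 n) with o | w <;> simp [h]
      rw [this]
      refine (MeasurableSet.iUnion fun o => ?_).union ?_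
      · exact (hact (measurableSet_singleton_observation o).inl_image).inter
          ((measurable_reveal o).comp measurable_snd hB)
      · exact (hact measurableSet_range_inr).inter (MeasurableSet.const _)
    · simp only [transcript, Fin.snoc_castSucc]
      exact (measurable_pi_apply j).comp ih

lemma measurable_decision (A : LAOAlgorithm d Ω) (n : ℕ) :
    Measurable fun p : Ω × (ℕ → LabeledExample d) => A.decision p.1 p.2 n :=
  (A.measurable_act n).comp (measurable_fst.prodMk (A.measurable_transcript n))

lemma measurableSet_runningAt (A : LAOAlgorithm d Ω) (n : ℕ) :
    MeasurableSet {p : Ω × (ℕ → LabeledExample d) | A.RunningAt p.1 p.2 n} := by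
  have : {p : Ω × (ℕ → LabeledExample d) | A.RunningAt p.1 p.2 n} =
      ⋂ m : ℕ, ⋂ _ : m < n, {p | A.decision p.1 p.2 m ∈ Set.range Sum.inl} := by
    ext p; simp [RunningAt, eq_comm]
  rw [this]
  exact MeasurableSet.iInter fun m => MeasurableSet.iInter fun _ =>
    A.measurable_decision m measurableSet_range_inl

lemma measurableSet_mem_attributesSeen (A : LAOAlgorithm d Ω) (q : ℕ × Fin d) :
    MeasurableSet {p : Ω × (ℕ → LabeledExample d) | q ∈ A.attributesSeen p.1 p.2} := by
  have : {p : Ω × (ℕ → LabeledExample d) | q ∈ A.attributesSeen p.1 p.2} =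
      ⋃ n : ℕ, {p | A.RunningAt p.1 p.2 n} ∩
        {p | A.decision p.1 p.2 n ∈ Sum.inl '' {Sum.inl q}} := by
    ext p; simp [attributesSeen, observations]
  rw [this]
  exact MeasurableSet.iUnion fun n => (A.measurableSet_runningAt n).inter
    (A.measurable_decision n (measurableSet_singleton_observation _).inl_image)

lemma measurable_encard_attributesSeen (A : LAOAlgorithm d Ω) :
    Measurable fun p : Ω × (ℕ → LabeledExample d) =>
      ((A.attributesSeen p.1 p.2).encard : ℝ≥0∞) := by
  have : (fun p : Ω × (ℕ → LabeledExample d) =>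
      ((A.attributesSeen p.1 p.2).encard : ℝ≥0∞)) = fun p => ∑' q : ℕ × Fin d,
        {p : Ω × (ℕ → LabeledExample d) | q ∈ A.attributesSeen p.1 p.2}.indicator 1 p := by
    funext p
    rw [← ENNReal.tsum_set_one, tsum_subtype (A.attributesSeen p.1 p.2) fun _ => (1 : ℝ≥0∞)]
    rfl
  rw [this]
  exact Measurable.tsum fun q =>
    measurable_one.indicator (A.measurableSet_mem_attributesSeen q)

lemma measurableSet_returns (A : LAOAlgorithm d Ω) {B : Set (EuclideanSpace ℝ (Fin d))}
    (hB : MeasurableSet B) :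
    MeasurableSet {p : Ω × (ℕ → LabeledExample d) | ∃ w, A.Returns p.1 p.2 w ∧ w ∈ B} := by
  have : {p : Ω × (ℕ → LabeledExample d) | ∃ w, A.Returns p.1 p.2 w ∧ w ∈ B} =
      ⋃ n : ℕ, {p | A.RunningAt p.1 p.2 n} ∩ {p | A.decision p.1 p.2 n ∈ Sum.inr '' B} := by
    ext p
    simp only [Returns, Set.mem_ofPred_eq, Set.mem_iUnion, Set.mem_inter_iff, Set.mem_image]
    constructor
    · rintro ⟨w, ⟨n, hn, hw⟩, hB⟩
      exact ⟨n, hn, w, hB, hw.symm⟩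
    · rintro ⟨n, hn, w, hB, hw⟩
      exact ⟨w, ⟨n, hn, hw.symm⟩, hB⟩
  rw [this]
  exact MeasurableSet.iUnion fun n => (A.measurableSet_runningAt n).inter
    (A.measurable_decision n hB.inr_image)

/-! ### Attributes and examples -/

lemma encard_attributesSeen_le (A : LAOAlgorithm d Ω) {k : ℕ} (hk : 1 ≤ k)
    (hA : A.AttributeBudget k) (ω : Ω) (z : ℕ → LabeledExample d) :
    (A.attributesSeen ω z).encard ≤ k * (A.examplesSeen ω z).encard := by
  by_cases hfin : (A.examplesSeen ω z).Finite
  · obtain ⟨F, hF⟩ := hfin.exists_finset_coe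
    have hsub : A.attributesSeen ω z ⊆
        ((F.sigma fun t => ({i | (t, i) ∈ A.attributesSeen ω z} : Set (Fin d)).toFinite.toFinset).map
          (Equiv.sigmaEquivProd ℕ (Fin d)).toEmbedding : Finset (ℕ × Fin d)) := by
      rintro ⟨t, i⟩ h
      have ht : t ∈ F := by
        rw [← Finset.mem_coe, hF]
        exact ⟨_, h, rfl⟩
      simp only [Finset.coe_map, Set.mem_image, Finset.mem_coe, Finset.mem_sigma]
      exact ⟨⟨t, i⟩, ⟨ht, by simpa using h⟩, rfl⟩
    refine (Set.encard_le_encard hsub).trans ?_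
    rw [← hF, Set.encard_coe_eq_coe_finsetCard, Set.encard_coe_eq_coe_finsetCard,
      Finset.card_map, Finset.card_sigma]
    have : ∑ t ∈ F, (({i | (t, i) ∈ A.attributesSeen ω z} : Set (Fin d)).toFinite.toFinset).card
        ≤ k * F.card := by
      rw [mul_comm, ← smul_eq_mul]
      refine Finset.sum_le_card_nsmul _ _ _ fun t _ => ?_
      rw [← Set.ncard_eq_toFinset_card]
      exact hA ω z t
    exact_mod_cast this
  · rw [Set.Infinite.encard_eq hfin, ENat.mul_top (by positivity)]
    exact le_top

lemma expectedAttributes_le (A : LAOAlgorithm d Ω) {k : ℕ} (hk : 1 ≤ k)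
    (hA : A.AttributeBudget k) (ρ : Measure Ω) (D : Measure (LabeledExample d)) :
    A.expectedAttributes ρ D ≤ k * A.expectedExamples ρ D := by
  unfold expectedAttributes expectedExamples
  -- A finite constant passes through the integral without measurability of the number of examples
  -- seen.
  rw [← lintegral_const_mul' _ _ (ENNReal.natCast_ne_top k)]
  refine lintegral_mono fun p => ?_
  have := ENat.toENNReal_le.mpr (A.encard_attributesSeen_le hk hA p.1 p.2)
  simpa using this

end LAOAlgorithm

/-! ### The hard distributions -/

section Risk

variable {d : ℕ}

lemma intUnit_mul_self (u : ℤˣ) : ((u : ℤ) : ℝ) * ((u : ℤ) : ℝ) = 1 := by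
  rcases Int.units_eq_one_or u with rfl | rfl <;> norm_num

lemma abs_intUnit (u : ℤˣ) : |((u : ℤ) : ℝ)| = 1 := by
  rcases Int.units_eq_one_or u with rfl | rfl <;> norm_num

lemma isProbabilityMeasure_hardDistribution {T : Finset (Fin d)} (hT : T.Nonempty)
    (r : Fin d → ℤˣ) : IsProbabilityMeasure (hardDistribution T r) := by
  constructor
  simp only [hardDistribution, Measure.smul_apply, Measure.coe_finsetSum, Finset.sum_apply,
    measure_univ, Finset.sum_const, nsmul_eq_mul, mul_one, smul_eq_mul]
  exact ENNReal.inv_mul_cancel (by simpa using hT.ne_empty) (ENNReal.natCast_ne_top _)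

lemma ae_hardDistribution (T : Finset (Fin d)) (r : Fin d → ℤˣ) :
    ∀ᵐ z ∂hardDistribution T r, ‖z.1‖ ≤ 1 ∧ z.2 = 1 := by
  refine Measure.ae_smul_measure ?_ _
  rw [← Measure.sum_coe_finset, Measure.ae_sum_iff]
  intro i
  rw [ae_dirac_eq]
  simp [abs_intUnit]

lemma risk_hardDistribution (T : Finset (Fin d)) (r : Fin d → ℤˣ)
    (w : EuclideanSpace ℝ (Fin d)) :
    risk (hardDistribution T r) w =
      (T.card : ℝ)⁻¹ * ∑ i ∈ T, (1 / 2) * (((r i : ℤ) : ℝ) * w i - 1) ^ 2 := by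
  unfold risk hardDistribution
  rw [integral_smul_measure, integral_finsetSum_measure]
  · simp [EuclideanSpace.inner_single_right]
  · intro i _
    exact integrable_dirac enorm_lt_top

lemma hardRegressor_apply (T : Finset (Fin d)) (r : Fin d → ℤˣ) (i : Fin d) :
    hardRegressor T r i = if i ∈ T then ((r i : ℤ) : ℝ) / Real.sqrt T.card else 0 := by
  simp [hardRegressor, Finset.sum_apply]

lemma norm_hardRegressor_le (T : Finset (Fin d)) (r : Fin d → ℤˣ) :
    ‖hardRegressor T r‖ ≤ 1 := by
  rw [← sq_le_one_iff₀ (norm_nonneg _), EuclideanSpace.real_norm_sq_eq]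
  have h : ∀ i, hardRegressor T r i ^ 2 = if i ∈ T then 1 / (T.card : ℝ) else 0 := by
    intro i
    rw [hardRegressor_apply]
    split_ifs
    · rw [div_pow, Real.sq_sqrt (Nat.cast_nonneg _), sq, intUnit_mul_self]
    · simp
  rw [Finset.sum_congr rfl fun i _ => h i, Finset.sum_ite_mem, Finset.univ_inter, Finset.sum_const,
    nsmul_eq_mul, mul_one_div]
  exact div_self_le_one _

lemma risk_hardRegressor {T : Finset (Fin d)} (hT : T.Nonempty) (r : Fin d → ℤˣ) :
    risk (hardDistribution T r) (hardRegressor T r) = (1 / 2) * (1 - 1 / Real.sqrt T.card) ^ 2 := by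
  have : (T.card : ℝ) ≠ 0 := by simpa using hT.ne_empty
  rw [risk_hardDistribution]
  have h : ∀ i ∈ T, (1 / 2 : ℝ) * (((r i : ℤ) : ℝ) * hardRegressor T r i - 1) ^ 2 =
      (1 / 2) * (1 - 1 / Real.sqrt T.card) ^ 2 := by
    intro i hi
    rw [hardRegressor_apply, if_pos hi, ← mul_div_assoc, intUnit_mul_self]
    ring
  rw [Finset.sum_congr rfl h, Finset.sum_const, nsmul_eq_mul]
  field_simp

lemma sum_sq_le_norm_sq (T : Finset (Fin d)) (w : EuclideanSpace ℝ (Fin d)) :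
    ∑ i ∈ T, w i ^ 2 ≤ ‖w‖ ^ 2 := by
  rw [EuclideanSpace.real_norm_sq_eq]
  exact Finset.sum_le_sum_of_subset_of_nonneg (Finset.subset_univ _) fun _ _ _ => sq_nonneg _

lemma abs_sum_sign_mul_le (T : Finset (Fin d)) (r : Fin d → ℤˣ)
    {w : EuclideanSpace ℝ (Fin d)} (hw : ‖w‖ ≤ 1) :
    |∑ i ∈ T, ((r i : ℤ) : ℝ) * w i| ≤ Real.sqrt T.card := by
  apply Real.abs_le_sqrt
  have h := Finset.sum_mul_sq_le_sq_mul_sq T (fun i => ((r i : ℤ) : ℝ)) (fun i => w i)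
  have h1 : ∑ i ∈ T, ((r i : ℤ) : ℝ) ^ 2 = T.card := by
    simp [sq, intUnit_mul_self]
  rw [h1] at h
  have h2 := sum_sq_le_norm_sq T w
  have h3 : ‖w‖ ^ 2 ≤ 1 := by nlinarith [norm_nonneg w]
  nlinarith [(Nat.cast_nonneg T.card : (0 : ℝ) ≤ _)]

/-- The risk in terms of the correlation with the signs. -/
lemma card_mul_risk {T : Finset (Fin d)} (hT : T.Nonempty) (r : Fin d → ℤˣ)
    (w : EuclideanSpace ℝ (Fin d)) :
    T.card * risk (hardDistribution T r) w =
      (1 / 2) * ∑ i ∈ T, w i ^ 2 - ∑ i ∈ T, ((r i : ℤ) : ℝ) * w i + T.card / 2 := by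
  have : (T.card : ℝ) ≠ 0 := by simpa using hT.ne_empty
  rw [risk_hardDistribution, mul_inv_cancel_left₀ this, Finset.mul_sum]
  have h : ∀ i ∈ T, (1 / 2 : ℝ) * (((r i : ℤ) : ℝ) * w i - 1) ^ 2 =
      (1 / 2) * w i ^ 2 - ((r i : ℤ) : ℝ) * w i + 1 / 2 := by
    intro i _
    have := intUnit_mul_self (r i)
    linear_combination (1 / 2) * w i ^ 2 * this
  rw [Finset.sum_congr rfl h, Finset.sum_add_distrib, Finset.sum_sub_distrib]
  simp
  ring

/-- With correlation `s`, Cauchy–Schwarz gives `K * risk ≥ (K - s) ^ 2 / (2 * K)`; this is smallest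
at the largest possible value `s = √K`. -/
lemma risk_hardRegressor_le {T : Finset (Fin d)} (hT : T.Nonempty) (r : Fin d → ℤˣ)
    {u : EuclideanSpace ℝ (Fin d)} (hu : ‖u‖ ≤ 1) :
    risk (hardDistribution T r) (hardRegressor T r) ≤ risk (hardDistribution T r) u := by
  have hK : (1 : ℝ) ≤ T.card := by exact_mod_cast hT.card_pos
  set K : ℝ := (T.card : ℝ) with hKdef
  have hs : 1 ≤ Real.sqrt K := Real.one_le_sqrt.mpr hK
  have hsq : Real.sqrt K ^ 2 = K := Real.sq_sqrt (by linarith)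
  refine le_of_mul_le_mul_left ?_ (by linarith : 0 < K)
  rw [card_mul_risk hT r u, risk_hardRegressor hT]
  have h1 := (abs_le.mp (abs_sum_sign_mul_le T r hu)).2
  have h2 := Finset.sum_mul_sq_le_sq_mul_sq T (fun i => ((r i : ℤ) : ℝ)) (fun i => u i)
  have h3 : ∑ i ∈ T, ((r i : ℤ) : ℝ) ^ 2 = K := by simp [sq, intUnit_mul_self, hKdef]
  rw [h3] at h2
  set s := ∑ i ∈ T, ((r i : ℤ) : ℝ) * u i
  set q := ∑ i ∈ T, u i ^ 2
  set m := Real.sqrt K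
  have hm : K * (1 / 2 * (1 - 1 / m) ^ 2) = 1 / 2 * (m - 1) ^ 2 := by
    rw [← hsq]; field_simp
  rw [← hKdef, hm]
  refine le_of_mul_le_mul_left ?_ (by linarith : 0 < K)
  rw [← hsq] at h2 ⊢
  have : (m * (m - 1)) ^ 2 ≤ (m ^ 2 - s) ^ 2 := by
    apply pow_le_pow_left₀
    · nlinarith
    · nlinarith
  nlinarith

/-- With `m = √K`, success gives correlation at least `m - 1/2 - m/8`, and `K ≥ 16` makes `1/2 ≤
m/8`. -/
lemma correlation_of_success {T : Finset (Fin d)} (r : Fin d → ℤˣ) {ε : ℝ}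
    (hT : 16 ≤ T.card) (hε : ε * Real.sqrt T.card ≤ 1 / 8)
    {w : EuclideanSpace ℝ (Fin d)}
    (h : risk (hardDistribution T r) w - risk (hardDistribution T r) (hardRegressor T r) ≤ ε) :
    3 / 4 * Real.sqrt T.card ≤ ∑ i ∈ T, ((r i : ℤ) : ℝ) * w i := by
  have hne : T.Nonempty := Finset.card_pos.mp (by omega)
  have hK : (16 : ℝ) ≤ T.card := by exact_mod_cast hT
  have h1 := card_mul_risk hne r w
  have h2 := risk_hardRegressor hne r
  set K : ℝ := (T.card : ℝ) with hKdef
  set m := Real.sqrt K with hm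
  have hs : 4 ≤ m := Real.le_sqrt_of_sq_le (by linarith)
  have hsq : m ^ 2 = K := Real.sq_sqrt (by linarith)
  have hm : K * (1 / 2 * (1 - 1 / m) ^ 2) = 1 / 2 * (m - 1) ^ 2 := by
    rw [← hsq]; field_simp
  have h3 := mul_le_mul_of_nonneg_left h (by linarith : 0 ≤ K)
  rw [mul_sub, h2, h1, hm] at h3
  have h4 : K * ε ≤ m / 8 := by rw [← hsq]; nlinarith
  have h5 : 0 ≤ ∑ i ∈ T, w i ^ 2 := Finset.sum_nonneg fun _ _ => sq_nonneg _
  nlinarith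

lemma correlation_pos_of_success {i : Fin d} (r : Fin d → ℤˣ) {ε : ℝ} (hε : ε < 1 / 2)
    {w : EuclideanSpace ℝ (Fin d)}
    (h : risk (hardDistribution {i} r) w -
      risk (hardDistribution {i} r) (hardRegressor {i} r) ≤ ε) :
    0 < ((r i : ℤ) : ℝ) * w i := by
  have h1 := risk_hardDistribution {i} r w
  have h2 := risk_hardRegressor (Finset.singleton_nonempty i) r
  simp at h1 h2
  rw [h1, h2] at h
  by_contra hle
  nlinarith

end Risk

/-! ### The hidden instance: a random injection and random signs -/

section Hidden

variable {d K : ℕ} {Ω : Type*} [MeasurableSpace Ω]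

/-- The hard example in direction `s j` with the sign that `r` prescribes there. -/
noncomputable def hiddenExample (s : Fin K ↪ Fin d) (r : Fin d → ℤˣ) (j : Fin K) :
    LabeledExample d :=
  (EuclideanSpace.single (s j) (((r (s j) : ℤ) : ℝ)), 1)

/-- The training sequence that visits the hidden directions in the order `J`. -/
noncomputable def hiddenSeq (s : Fin K ↪ Fin d) (r : Fin d → ℤˣ) (J : ℕ → Fin K) :
    ℕ → LabeledExample d :=
  fun t => hiddenExample s r (J t)

lemma reveal_hiddenSeq_inl (s : Fin K ↪ Fin d) (r : Fin d → ℤˣ) (J : ℕ → Fin K) (t : ℕ)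
    (i : Fin d) :
    reveal (hiddenSeq s r J) (Sum.inl (t, i)) = if i = s (J t) then ((r i : ℤ) : ℝ) else 0 := by
  simp only [reveal, hiddenSeq, hiddenExample, PiLp.single_apply]
  split_ifs with h
  · rw [h]
  · rfl

open Classical in
/-- The coordinates that the run probes on examples carrying the hidden index `j`. -/
noncomputable def probed (A : LAOAlgorithm d Ω) (ω : Ω) (J : ℕ → Fin K) (s : Fin K ↪ Fin d)
    (r : Fin d → ℤˣ) (j : Fin K) : Finset (Fin d) :=
  {i | ∃ t, J t = j ∧ (t, i) ∈ A.attributesSeen ω (hiddenSeq s r J)}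

/-- The hidden indices whose direction has been discovered by the run. -/
noncomputable def discovered (A : LAOAlgorithm d Ω) (ω : Ω) (J : ℕ → Fin K) (s : Fin K ↪ Fin d)
    (r : Fin d → ℤˣ) : Finset (Fin K) :=
  {j | s j ∈ probed A ω J s r j}

lemma mem_probed {A : LAOAlgorithm d Ω} {ω : Ω} {J : ℕ → Fin K} {s : Fin K ↪ Fin d}
    {r : Fin d → ℤˣ} {j : Fin K} {i : Fin d} :
    i ∈ probed A ω J s r j ↔
      ∃ t, J t = j ∧ Sum.inl (t, i) ∈ A.observations ω (hiddenSeq s r J) := by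
  simp only [probed, Finset.mem_filter, Finset.mem_univ, true_and]
  rfl

lemma mem_discovered {A : LAOAlgorithm d Ω} {ω : Ω} {J : ℕ → Fin K} {s : Fin K ↪ Fin d}
    {r : Fin d → ℤˣ} {j : Fin K} :
    j ∈ discovered A ω J s r ↔ s j ∈ probed A ω J s r j := by
  simp [discovered]

/-- The map `(t, i) ↦ (J t, i)` sends observed attributes onto probes and can only merge them. -/
lemma sum_card_probed_le (A : LAOAlgorithm d Ω) (ω : Ω) (J : ℕ → Fin K) (s : Fin K ↪ Fin d)
    (r : Fin d → ℤˣ) :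
    ((∑ j, (probed A ω J s r j).card : ℕ) : ℕ∞) ≤
      (A.attributesSeen ω (hiddenSeq s r J)).encard := by
  have hsub : ((Finset.univ.sigma (probed A ω J s r) : Finset (Σ _ : Fin K, Fin d)) : Set _) ⊆
      (fun q : ℕ × Fin d => (⟨J q.1, q.2⟩ : Σ _ : Fin K, Fin d)) ''
        A.attributesSeen ω (hiddenSeq s r J) := by
    rintro ⟨j, i⟩ h
    simp only [Finset.coe_sigma, Set.mem_sigma_iff, Finset.mem_coe, mem_probed] at h
    obtain ⟨-, t, rfl, ht⟩ := h
    exact ⟨(t, i), ht, rfl⟩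
  rw [← Finset.card_sigma, ← Set.encard_coe_eq_coe_finsetCard]
  exact (Set.encard_le_encard hsub).trans (Set.encard_image_le _ _)

/-! ### Undiscovered signs are balanced -/

/-- The sign vector `r` with the sign at `i` reversed. -/
def flipSign (i : Fin d) : Equiv.Perm (Fin d → ℤˣ) where
  toFun r := Function.update r i (-r i)
  invFun r := Function.update r i (-r i)
  left_inv r := by simp
  right_inv r := by simp

lemma reveal_flipSign_eq {s : Fin K ↪ Fin d} {r : Fin d → ℤˣ} {J : ℕ → Fin K} {j : Fin K}
    {o : Observation d} (h : ∀ t, J t = j → o ≠ Sum.inl (t, s j)) :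
    reveal (hiddenSeq s r J) o = reveal (hiddenSeq s (flipSign (s j) r) J) o := by
  rcases o with ⟨t, i⟩ | t
  · rw [reveal_hiddenSeq_inl, reveal_hiddenSeq_inl]
    split_ifs with hi
    · subst hi
      have : s (J t) ≠ s j := by
        intro h'
        exact h t (s.injective h') (by rw [h'])
      simp [flipSign, this]
    · rfl
  · rfl

/-- The outcome of a run, as a predicate on regressors, together with the discovered indices, does
not depend on the sign of an undiscovered direction. -/
lemma flipSign_run {A : LAOAlgorithm d Ω} {ω : Ω} {J : ℕ → Fin K} {s : Fin K ↪ Fin d}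
    {r : Fin d → ℤˣ} {j : Fin K} (hj : j ∉ discovered A ω J s r) :
    j ∉ discovered A ω J s (flipSign (s j) r) ∧
      A.Returns ω (hiddenSeq s (flipSign (s j) r) J) = A.Returns ω (hiddenSeq s r J) := by
  have h : ∀ o ∈ A.observations ω (hiddenSeq s r J),
      reveal (hiddenSeq s r J) o = reveal (hiddenSeq s (flipSign (s j) r) J) o := by
    intro o ho
    refine reveal_flipSign_eq fun t ht hot => hj ?_
    rw [mem_discovered, mem_probed]
    exact ⟨t, ht, hot ▸ ho⟩
  constructor
  · rw [mem_discovered, mem_probed] at hj ⊢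
    rintro ⟨t, ht, hot⟩
    exact hj ⟨t, ht, LAOAlgorithm.observations_subset_of_reveal_eq
      (fun o _ ho' => (h o ho').symm) hot⟩
  · funext w
    exact propext ⟨LAOAlgorithm.Returns.congr fun o _ ho' => (h o ho').symm,
      LAOAlgorithm.Returns.congr fun o ho _ => h o ho⟩

/-- For each `j`, `flipSign (s j)` is an involution that reverses the summand. Since a run may never
stop, `φ` acts on the predicate "returned" instead of on a regressor. -/
lemma sum_undiscovered_eq_zero (A : LAOAlgorithm d Ω) (ω : Ω) (J : ℕ → Fin K)
    (s : Fin K ↪ Fin d) (φ : (EuclideanSpace ℝ (Fin d) → Prop) → Fin d → ℝ) :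
    ∑ r : Fin d → ℤˣ, ∑ j with j ∉ discovered A ω J s r,
      ((r (s j) : ℤ) : ℝ) * φ (A.Returns ω (hiddenSeq s r J)) (s j) = 0 := by
  simp only [Finset.sum_filter]
  rw [Finset.sum_comm]
  refine Finset.sum_eq_zero fun j _ => ?_
  set g : (Fin d → ℤˣ) → ℝ := fun r => if j ∉ discovered A ω J s r then
    ((r (s j) : ℤ) : ℝ) * φ (A.Returns ω (hiddenSeq s r J)) (s j) else 0 with hg
  have hflip : ∀ r, g (flipSign (s j) r) = -g r := by
    intro r
    have hinv : flipSign (s j) (flipSign (s j) r) = r := (flipSign (s j)).left_inv r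
    by_cases hj : j ∉ discovered A ω J s r
    · obtain ⟨h1, h2⟩ := flipSign_run hj
      simp only [hg, if_pos hj, if_pos h1, h2]
      simp [flipSign]
    · have h1 : ¬ j ∉ discovered A ω J s (flipSign (s j) r) := by
        intro h
        have := (flipSign_run h).1
        rw [hinv] at this
        exact hj this
      simp only [hg, if_neg hj, if_neg h1, neg_zero]
  have hsum := Equiv.sum_comp (flipSign (s j)) g
  simp only [hflip, Finset.sum_neg_distrib] at hsum
  linarith

/-- If success forces correlation with the signs and few discoveries force small correlation, then
success requires many discoveries. -/
lemma success_le_discovered (A : LAOAlgorithm d Ω) (ω : Ω) (J : ℕ → Fin K)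
    (s : Fin K ↪ Fin d) (φ : (EuclideanSpace ℝ (Fin d) → Prop) → Fin d → ℝ)
    (S : Finset (Fin d → ℤˣ)) {m : ℝ} (hm : 0 < m)
    (hgood : ∀ r ∈ S, 3 / 4 * m ≤
      ∑ j, ((r (s j) : ℤ) : ℝ) * φ (A.Returns ω (hiddenSeq s r J)) (s j))
    (hbad : ∀ r, -m ≤ ∑ j, ((r (s j) : ℤ) : ℝ) * φ (A.Returns ω (hiddenSeq s r J)) (s j))
    (hdisc : ∀ r, K * ∑ j ∈ discovered A ω J s r,
        ((r (s j) : ℤ) : ℝ) * φ (A.Returns ω (hiddenSeq s r J)) (s j) ≤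
      m * (K / 12 + 3 * (discovered A ω J s r).card)) :
    21 * K * S.card ≤ 13 * K * 2 ^ d + 36 * ∑ r, (discovered A ω J s r).card := by
  classical
  set X : (Fin d → ℤˣ) → Fin K → ℝ := fun r j =>
    ((r (s j) : ℤ) : ℝ) * φ (A.Returns ω (hiddenSeq s r J)) (s j) with hX
  have h0 := sum_undiscovered_eq_zero A ω J s φ
  have h1 : ∑ r, ∑ j, X r j = ∑ r, ∑ j ∈ discovered A ω J s r, X r j := by
    have : ∀ r, ∑ j, X r j = ∑ j ∈ discovered A ω J s r, X r j +
        ∑ j with j ∉ discovered A ω J s r, X r j := by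
      intro r
      rw [← Finset.sum_filter_add_sum_filter_not Finset.univ (fun j => j ∈ discovered A ω J s r)]
      congr 2
      ext; simp
    rw [Finset.sum_congr rfl fun r _ => this r, Finset.sum_add_distrib, h0, add_zero]
  have h2 : (7 / 4 * S.card - 2 ^ d) * m ≤ ∑ r, ∑ j, X r j := by
    -- The coefficient interpolates `3/4` on `S` and `-1` off `S`.
    have : ∀ r, (7 / 4 * (if r ∈ S then 1 else 0) - 1) * m ≤ ∑ j, X r j := by
      intro r
      split_ifs with h
      · have := hgood r h
        linarith
      · have := hbad r
        linarith
    refine le_trans (le_of_eq ?_) (Finset.sum_le_sum fun r _ => this r)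
    rw [← Finset.sum_mul, Finset.sum_sub_distrib, ← Finset.mul_sum]
    simp
  have h3 : K * ∑ r, ∑ j ∈ discovered A ω J s r, X r j ≤
      m * (2 ^ d * K / 12 + 3 * ∑ r, ((discovered A ω J s r).card : ℝ)) := by
    rw [Finset.mul_sum]
    refine (Finset.sum_le_sum fun r _ => hdisc r).trans (le_of_eq ?_)
    have hc : (Fintype.card (Fin d → ℤˣ) : ℝ) = 2 ^ d := by simp
    rw [← Finset.mul_sum, Finset.sum_add_distrib, ← Finset.mul_sum, Finset.sum_const,
      Finset.card_univ, nsmul_eq_mul, hc]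
    ring
  have h4 := mul_le_mul_of_nonneg_left h2 (Nat.cast_nonneg K : (0 : ℝ) ≤ K)
  have h5 : m * (K * (7 / 4 * S.card - 2 ^ d)) ≤
      m * (2 ^ d * K / 12 + 3 * ∑ r, ((discovered A ω J s r).card : ℝ)) := by
    rw [h1] at h4
    linarith
  have h6 := le_of_mul_le_mul_left h5 hm
  -- Multiplication by 12 turns `7/4`, `1 + 1/12` and `3` into 21, 13 and 36.
  have h7 : (21 * K * S.card : ℝ) ≤ 13 * K * 2 ^ d + 36 * ∑ r, ((discovered A ω J s r).card : ℝ) := by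
    linarith
  exact_mod_cast h7

/-! ### Discoveries are expensive -/

/-- The injection `s` with the value at `j` moved to `i` (and `i` moved to `s j`). -/
def moveTo (s : Fin K ↪ Fin d) (j : Fin K) (i : Fin d) : Fin K ↪ Fin d :=
  s.trans (Equiv.swap (s j) i).toEmbedding

@[simp] lemma moveTo_self (s : Fin K ↪ Fin d) (j : Fin K) (i : Fin d) : moveTo s j i j = i := by
  simp [moveTo]

lemma moveTo_of_ne {s : Fin K ↪ Fin d} {j l : Fin K} {i : Fin d} (hl : l ≠ j) (hi : s l ≠ i) :
    moveTo s j i l = s l := by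
  simp only [moveTo, Function.Embedding.trans_apply, Equiv.coe_toEmbedding]
  exact Equiv.swap_apply_of_ne_of_ne (fun h => hl (s.injective h)) hi

lemma moveTo_moveTo (s : Fin K ↪ Fin d) (j : Fin K) (i : Fin d) :
    moveTo (moveTo s j i) j (s j) = s := by
  ext l
  simp only [moveTo, Function.Embedding.trans_apply, Equiv.coe_toEmbedding, Equiv.swap_apply_left]
  rw [Equiv.swap_comm i, Equiv.swap_apply_self]

/-- The coordinates to which the value at `j` can be moved. -/
def freeFor (s : Fin K ↪ Fin d) (j : Fin K) : Finset (Fin d) :=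
  {i | ∀ l, l ≠ j → s l ≠ i}

lemma mem_freeFor {s : Fin K ↪ Fin d} {j : Fin K} {i : Fin d} :
    i ∈ freeFor s j ↔ ∀ l, l ≠ j → s l ≠ i := by
  simp [freeFor]

lemma card_freeFor (s : Fin K ↪ Fin d) (j : Fin K) : (freeFor s j).card + K = d + 1 := by
  have h : freeFor s j = ((Finset.univ.erase j).map s)ᶜ := by
    ext i
    simp only [mem_freeFor, Finset.mem_compl, Finset.mem_map, Finset.mem_erase, Finset.mem_univ,
      and_true, not_exists, not_and, ne_eq]
  have hK : 0 < K := j.pos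
  have hd : K ≤ d := by simpa using Fintype.card_le_of_embedding s
  rw [h, Finset.card_compl, Finset.card_map, Finset.card_erase_of_mem (Finset.mem_univ j)]
  simp
  omega

/-- Moving the value of `s` at `j` within the free coordinates, as an involution. -/
def moveEquiv (j : Fin K) : Equiv.Perm ((Fin K ↪ Fin d) × Fin d) where
  toFun p := (moveTo p.1 j p.2, p.1 j)
  invFun p := (moveTo p.1 j p.2, p.1 j)
  left_inv p := by simp [moveTo_moveTo]
  right_inv p := by simp [moveTo_moveTo]

lemma moveTo_freeFor {s : Fin K ↪ Fin d} {j : Fin K} {i : Fin d} (hi : i ∈ freeFor s j) :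
    s j ∈ freeFor (moveTo s j i) j := by
  rw [mem_freeFor] at hi ⊢
  intro l hl
  rw [moveTo_of_ne hl (hi l hl)]
  exact fun h => hl (s.injective h)

/-- The pairs `(s, i)` with `i` free are thus invariant under `moveEquiv j`, as the reindexing in
`discovered_le_probed` requires. -/
lemma moveTo_freeFor_iff {s : Fin K ↪ Fin d} {j : Fin K} {i : Fin d} :
    s j ∈ freeFor (moveTo s j i) j ↔ i ∈ freeFor s j := by
  refine ⟨fun h => ?_, moveTo_freeFor⟩
  have := moveTo_freeFor h
  rwa [moveTo_moveTo, moveTo_self] at this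

lemma reveal_moveTo_eq {s : Fin K ↪ Fin d} {r : Fin d → ℤˣ} {J : ℕ → Fin K} {j : Fin K} {i : Fin d}
    (hi : i ∈ freeFor s j) {o : Observation d}
    (h : ∀ t, J t = j → o ≠ Sum.inl (t, s j) ∧ o ≠ Sum.inl (t, i)) :
    reveal (hiddenSeq s r J) o = reveal (hiddenSeq (moveTo s j i) r J) o := by
  rcases o with ⟨t, i'⟩ | t
  · rw [reveal_hiddenSeq_inl, reveal_hiddenSeq_inl]
    by_cases ht : J t = j
    · obtain ⟨h1, h2⟩ := h t ht
      rw [ht, moveTo_self, if_neg, if_neg]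
      · rintro rfl; exact h2 rfl
      · rintro rfl; exact h1 rfl
    · rw [moveTo_of_ne ht (mem_freeFor.mp hi _ ht)]
  · rfl

/-- A discovery of `s j` costs a probe of `i`, now or when the hidden value is moved to `i`. -/
lemma probed_of_discovered {A : LAOAlgorithm d Ω} {ω : Ω} {J : ℕ → Fin K} {s : Fin K ↪ Fin d}
    {r : Fin d → ℤˣ} {j : Fin K} (hj : j ∈ discovered A ω J s r) {i : Fin d}
    (hi : i ∈ freeFor s j) :
    i ∈ probed A ω J s r j ∨ s j ∈ probed A ω J (moveTo s j i) r j := by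
  by_contra! hcon
  obtain ⟨h1, h2⟩ := hcon
  rw [mem_discovered] at hj
  rw [mem_probed] at h1 h2 hj
  obtain ⟨t, ht, hot⟩ := hj
  refine h2 ⟨t, ht, LAOAlgorithm.observations_subset_of_reveal_eq (fun o ho ho' => ?_) hot⟩
  -- Only `s j` and `i` on examples of index `j` can tell the runs apart. The moved run does not
  -- probe the former, the original run does not probe the latter, so no common observation differs.
  refine reveal_moveTo_eq hi fun t' ht' => ⟨?_, ?_⟩
  · rintro rfl
    exact h2 ⟨t', ht', ho'⟩
  · rintro rfl
    exact h1 ⟨t', ht', ho⟩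

/-- Each discovery is charged to all `d + 1 - K` free positions. A charge falls on a probe of the
same run or of the moved run; the involution makes the second total no larger than the first bound,
whence the factor 2. -/
lemma discovered_le_probed (A : LAOAlgorithm d Ω) (ω : Ω) (J : ℕ → Fin K) (r : Fin d → ℤˣ)
    (j : Fin K) :
    (d + 1 - K) * ∑ s : Fin K ↪ Fin d, (if j ∈ discovered A ω J s r then 1 else 0) ≤
      2 * ∑ s : Fin K ↪ Fin d, (probed A ω J s r j).card := by
  have h1 : ∀ s : Fin K ↪ Fin d, (d + 1 - K) * (if j ∈ discovered A ω J s r then 1 else 0) ≤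
      (probed A ω J s r j).card + ∑ i, if i ∈ freeFor s j ∧
        s j ∈ probed A ω J (moveTo s j i) r j then 1 else 0 := by
    intro s
    split_ifs with hj
    · have hsub : freeFor s j ⊆ probed A ω J s r j ∪ ({i | i ∈ freeFor s j ∧
          s j ∈ probed A ω J (moveTo s j i) r j} : Finset (Fin d)) := by
        intro i hi
        rcases probed_of_discovered hj hi with h | h
        · exact Finset.mem_union_left _ h
        · exact Finset.mem_union_right _ (by simp [hi, h])
      have h := (Finset.card_le_card hsub).trans (Finset.card_union_le _ _)
      rw [Finset.card_filter] at h
      have := card_freeFor s j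
      omega
    · simp
  have h2 : ∑ s : Fin K ↪ Fin d, ∑ i, (if i ∈ freeFor s j ∧
        s j ∈ probed A ω J (moveTo s j i) r j then 1 else 0) ≤
      ∑ s : Fin K ↪ Fin d, (probed A ω J s r j).card := by
    rw [← Fintype.sum_prod_type' (f := fun (s : Fin K ↪ Fin d) i => if i ∈ freeFor s j ∧
        s j ∈ probed A ω J (moveTo s j i) r j then 1 else 0)]
    have : ∀ p : (Fin K ↪ Fin d) × Fin d, (if p.2 ∈ freeFor p.1 j ∧
        p.1 j ∈ probed A ω J (moveTo p.1 j p.2) r j then 1 else 0) =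
        (fun q : (Fin K ↪ Fin d) × Fin d => if q.2 ∈ freeFor q.1 j ∧
          q.2 ∈ probed A ω J q.1 r j then 1 else 0) (moveEquiv j p) := by
      intro p
      simp only [moveEquiv, Equiv.coe_fn_mk, moveTo_freeFor_iff]
    rw [Finset.sum_congr rfl fun p _ => this p,
      Equiv.sum_comp (moveEquiv j) (fun q : (Fin K ↪ Fin d) × Fin d => if q.2 ∈ freeFor q.1 j ∧
          q.2 ∈ probed A ω J q.1 r j then 1 else 0), Fintype.sum_prod_type]
    refine Finset.sum_le_sum fun s _ => ?_
    rw [← Finset.card_filter]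
    exact Finset.card_le_card fun i hi => (Finset.mem_filter.mp hi).2.2
  rw [Finset.mul_sum]
  refine (Finset.sum_le_sum fun s _ => h1 s).trans ?_
  rw [Finset.sum_add_distrib]
  omega

lemma sum_discovered_le_probed (A : LAOAlgorithm d Ω) (ω : Ω) (J : ℕ → Fin K) :
    (d + 1 - K) * ∑ s : Fin K ↪ Fin d, ∑ r, (discovered A ω J s r).card ≤
      2 * ∑ s : Fin K ↪ Fin d, ∑ r, ∑ j, (probed A ω J s r j).card := by
  have h : ∀ (s : Fin K ↪ Fin d) r, (discovered A ω J s r).card =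
      ∑ j, if j ∈ discovered A ω J s r then 1 else 0 := by
    intro s r; simp
  simp only [h]
  rw [Finset.sum_comm, Finset.sum_comm (s := (Finset.univ : Finset (Fin K ↪ Fin d))),
    Finset.mul_sum, Finset.mul_sum]
  refine Finset.sum_le_sum fun r _ => ?_
  rw [Finset.sum_comm, Finset.sum_comm (s := (Finset.univ : Finset (Fin K ↪ Fin d))),
    Finset.mul_sum, Finset.mul_sum]
  exact Finset.sum_le_sum fun j _ => discovered_le_probed A ω J r j

end Hidden

/-! ### Counting over instances for fixed randomness and fixed index order -/

section Pointwise

variable {d K : ℕ} {Ω : Type*} [MeasurableSpace Ω]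

/-- The algorithm succeeds on the training sequence `z`, for the instance `(T, r)`. -/
def Succeeds (A : LAOAlgorithm d Ω) (T : Finset (Fin d)) (r : Fin d → ℤˣ) (ε : ℝ)
    (ω : Ω) (z : ℕ → LabeledExample d) : Prop :=
  ∃ w, A.Returns ω z w ∧ ‖w‖ ≤ 1 ∧
    risk (hardDistribution T r) w - risk (hardDistribution T r) (hardRegressor T r) ≤ ε

open Classical in
/-- A point of the unit ball satisfying `P`, or `0` if there is none. -/
noncomputable def ballChoice (P : EuclideanSpace ℝ (Fin d) → Prop) : EuclideanSpace ℝ (Fin d) :=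
  if h : ∃ w, P w ∧ ‖w‖ ≤ 1 then h.choose else 0

lemma norm_ballChoice_le (P : EuclideanSpace ℝ (Fin d) → Prop) : ‖ballChoice P‖ ≤ 1 := by
  unfold ballChoice
  split_ifs with h
  · exact h.choose_spec.2
  · simp

lemma ballChoice_returns {A : LAOAlgorithm d Ω} {ω : Ω} {z : ℕ → LabeledExample d}
    {w : EuclideanSpace ℝ (Fin d)} (hw : A.Returns ω z w) (h1 : ‖w‖ ≤ 1) :
    ballChoice (A.Returns ω z) = w := by
  have h : ∃ w, A.Returns ω z w ∧ ‖w‖ ≤ 1 := ⟨w, hw, h1⟩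
  rw [ballChoice, dif_pos h]
  exact h.choose_spec.1.unique hw

/-- The parameters for which success reveals many hidden directions. -/
def Informative (K : ℕ) (ε : ℝ) : Prop :=
  (K = 1 ∧ ε < 1 / 2) ∨ (16 ≤ K ∧ ε * Real.sqrt K ≤ 1 / 8)

-- For `K = 1` success yields only a correct sign of the output coordinate, so the test function is
-- that sign and `m = 1`. For `K ≥ 16` it is the output itself and `m = √K`.
open Classical in
lemma success_le_discovered_of_informative (A : LAOAlgorithm d Ω) (ω : Ω) (J : ℕ → Fin K)
    (s : Fin K ↪ Fin d) {ε : ℝ} (h : Informative K ε) :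
    21 * K * (∑ r, if Succeeds A (Finset.univ.map s) r ε ω (hiddenSeq s r J) then 1 else 0) ≤
      13 * K * 2 ^ d + 36 * ∑ r, (discovered A ω J s r).card := by
  rw [← Finset.card_filter]
  rcases h with ⟨rfl, hε⟩ | ⟨hK, hε⟩
  · refine success_le_discovered A ω J s
      (fun P i => ((SignType.sign (ballChoice P i) : SignType) : ℝ)) _ one_pos ?_ ?_ ?_
    · intro r hr
      obtain ⟨w, hw, h1, hrisk⟩ := (Finset.mem_filter.mp hr).2
      simp only [ballChoice_returns hw h1]
      have hT : (Finset.univ : Finset (Fin 1)).map s = {s 0} := by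
        ext; simp
      rw [hT] at hrisk
      have := correlation_pos_of_success r hε hrisk
      rw [Fin.sum_univ_one]
      rcases Int.units_eq_one_or (r (s 0)) with h | h
      · rw [h] at this ⊢
        rw [sign_pos (by simpa using this)]
        norm_num
      · rw [h] at this ⊢
        rw [sign_neg (by simpa using this)]
        norm_num
    · intro r
      rw [Fin.sum_univ_one]
      rcases Int.units_eq_one_or (r (s 0)) with h | h <;> rw [h] <;>
        rcases SignType.trichotomy (SignType.sign (ballChoice (A.Returns ω (hiddenSeq s r J)) (s 0)))
          with h' | h' | h' <;> rw [h'] <;> norm_num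
    · intro r
      have : ∑ j ∈ discovered A ω J s r, ((r (s j) : ℤ) : ℝ) * ((SignType.sign
          (ballChoice (A.Returns ω (hiddenSeq s r J)) (s j)) : SignType) : ℝ) ≤
          ∑ j ∈ discovered A ω J s r, (1 : ℝ) := by
        refine Finset.sum_le_sum fun j _ => ?_
        rcases Int.units_eq_one_or (r (s j)) with h | h <;> rw [h] <;>
          rcases SignType.trichotomy
            (SignType.sign (ballChoice (A.Returns ω (hiddenSeq s r J)) (s j)))
            with h' | h' | h' <;> rw [h'] <;> norm_num
      rw [Finset.sum_const, nsmul_eq_mul, mul_one] at this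
      have h0 : (0 : ℝ) ≤ (discovered A ω J s r).card := Nat.cast_nonneg _
      push_cast
      linarith
  · have hcard : ((Finset.univ : Finset (Fin K)).map s).card = K := by simp
    have hKpos : (0 : ℝ) < K := by exact_mod_cast (by omega : 0 < K)
    have hm : 0 < Real.sqrt K := Real.sqrt_pos.mpr hKpos
    have hsum : ∀ (F : Finset (Fin K)) (r : Fin d → ℤˣ) (w : EuclideanSpace ℝ (Fin d)),
        ∑ j ∈ F, ((r (s j) : ℤ) : ℝ) * w (s j) = ∑ i ∈ F.map s, ((r i : ℤ) : ℝ) * w i := by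
      intro F r w; rw [Finset.sum_map]
    refine success_le_discovered A ω J s (fun P i => ballChoice P i) _ hm ?_ ?_ ?_
    · intro r hr
      obtain ⟨w, hw, h1, hrisk⟩ := (Finset.mem_filter.mp hr).2
      simp only [ballChoice_returns hw h1]
      have := correlation_of_success r (by rwa [hcard]) (by rwa [hcard]) hrisk
      rwa [hcard, ← hsum] at this
    · intro r
      have := (abs_le.mp (abs_sum_sign_mul_le (Finset.univ.map s) r
        (norm_ballChoice_le (A.Returns ω (hiddenSeq s r J))))).1
      rwa [hcard, ← hsum] at this
    · intro r
      have := (abs_le.mp (abs_sum_sign_mul_le ((discovered A ω J s r).map s) r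
        (norm_ballChoice_le (A.Returns ω (hiddenSeq s r J))))).2
      rw [Finset.card_map, ← hsum] at this
      refine (mul_le_mul_of_nonneg_left this hKpos.le).trans ?_
      set n : ℝ := ((discovered A ω J s r).card : ℝ)
      have hn : 0 ≤ n := Nat.cast_nonneg _
      have h1 := Real.sq_sqrt hn
      have h2 := Real.sq_sqrt hKpos.le
      nth_rewrite 1 3 [← h2]
      nth_rewrite 2 [← h1]
      -- This is `√K * √n ≤ K / 12 + 3 * n`, the source of the constants in `hdisc`.
      nlinarith [mul_nonneg hm.le (sq_nonneg (Real.sqrt K - 6 * Real.sqrt n))]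

open Classical in
lemma success_le_attributesSeen (A : LAOAlgorithm d Ω) (ω : Ω) (J : ℕ → Fin K)
    {ε : ℝ} (h : Informative K ε) :
    ((21 * K * (d + 1 - K) : ℕ) : ℝ≥0∞) * (∑ s : Fin K ↪ Fin d, ∑ r,
        if Succeeds A (Finset.univ.map s) r ε ω (hiddenSeq s r J) then 1 else 0) ≤
      ((13 * K * (d + 1 - K) * (d.descFactorial K * 2 ^ d) : ℕ) : ℝ≥0∞) +
        72 * ∑ s : Fin K ↪ Fin d, ∑ r,
          ((A.attributesSeen ω (hiddenSeq s r J)).encard : ℝ≥0∞) := by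
  have h1 : 21 * K * (d + 1 - K) * (∑ s : Fin K ↪ Fin d, ∑ r,
        if Succeeds A (Finset.univ.map s) r ε ω (hiddenSeq s r J) then 1 else 0) ≤
      13 * K * (d + 1 - K) * (d.descFactorial K * 2 ^ d) +
        72 * ∑ s : Fin K ↪ Fin d, ∑ r, ∑ j, (probed A ω J s r j).card := by
    have h2 := Finset.sum_le_sum fun s (_ : s ∈ (Finset.univ : Finset (Fin K ↪ Fin d))) =>
      success_le_discovered_of_informative A ω J s h
    rw [← Finset.mul_sum, Finset.sum_add_distrib, ← Finset.mul_sum, Finset.sum_const,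
      Finset.card_univ, Fintype.card_embedding_eq, Fintype.card_fin, Fintype.card_fin,
      smul_eq_mul, ← Finset.mul_sum] at h2
    have h3 := sum_discovered_le_probed A ω J
    have h4 := Nat.mul_le_mul_left (d + 1 - K) h2
    generalize d + 1 - K = D at *
    generalize d.descFactorial K = N at *
    generalize (2 : ℕ) ^ d = M at *
    nlinarith
  calc _ = ((21 * K * (d + 1 - K) * (∑ s : Fin K ↪ Fin d, ∑ r,
        if Succeeds A (Finset.univ.map s) r ε ω (hiddenSeq s r J) then 1 else 0) : ℕ) : ℝ≥0∞) := by
        push_cast; rfl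
    _ ≤ _ := Nat.cast_le.mpr h1
    _ ≤ _ := by
        rw [Nat.cast_add]
        gcongr
        rw [Nat.cast_mul, Nat.cast_sum]
        gcongr with s
        · norm_num
        · rw [Nat.cast_sum]
          gcongr with r
          have := ENat.toENNReal_le.mpr (sum_card_probed_le A ω J s r)
          rwa [ENat.toENNReal_coe] at this

end Pointwise

/-! ### Integration over the randomness and the index order -/

section Averaging

variable {d K : ℕ} {Ω : Type*} [MeasurableSpace Ω]

/-- The uniform distribution on the hidden indices. -/
noncomputable def uniformIndex (K : ℕ) : Measure (Fin K) :=
  (K : ℝ≥0∞)⁻¹ • ∑ j, Measure.dirac j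

lemma isProbabilityMeasure_uniformIndex (hK : 1 ≤ K) : IsProbabilityMeasure (uniformIndex K) := by
  constructor
  simp only [uniformIndex, Measure.smul_apply, Measure.coe_finsetSum, Finset.sum_apply,
    measure_univ, Finset.sum_const, nsmul_eq_mul, mul_one, smul_eq_mul, Finset.card_univ,
    Fintype.card_fin]
  exact ENNReal.inv_mul_cancel (by simp; omega) (ENNReal.natCast_ne_top _)

lemma map_uniformIndex (s : Fin K ↪ Fin d) (r : Fin d → ℤˣ) :
    (uniformIndex K).map (hiddenExample s r) = hardDistribution (Finset.univ.map s) r := by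
  rw [uniformIndex, hardDistribution, Measure.map_smul, Finset.card_map, Finset.sum_map,
    Finset.card_univ, Fintype.card_fin, ← Measure.mapₗ_apply_of_measurable (measurable_of_finite _),
    map_sum]
  congr 1
  refine Finset.sum_congr rfl fun j _ => ?_
  rw [Measure.mapₗ_apply_of_measurable (measurable_of_finite _),
    Measure.map_dirac' (measurable_of_finite _)]
  rfl

lemma measurable_hiddenSeq (s : Fin K ↪ Fin d) (r : Fin d → ℤˣ) :
    Measurable (hiddenSeq s r) :=
  measurable_pi_iff.mpr fun t => (measurable_of_finite (hiddenExample s r)).comp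
    (measurable_pi_apply t)

/-- A coupling: one law of `(ω, J)`, independent of `(s, r)`, drives all instances, so the pointwise
count can be integrated. -/
lemma runLaw_hardDistribution (hK : 1 ≤ K) (ρ : Measure Ω) [IsProbabilityMeasure ρ]
    (s : Fin K ↪ Fin d) (r : Fin d → ℤˣ) :
    runLaw ρ (hardDistribution (Finset.univ.map s) r) =
      (ρ.prod (Measure.infinitePi fun _ : ℕ => uniformIndex K)).map
        (Prod.map id (hiddenSeq s r)) := by
  have := isProbabilityMeasure_uniformIndex hK
  rw [← Measure.map_prod_map _ _ measurable_id (measurable_hiddenSeq s r), Measure.map_id, runLaw]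
  congr 1
  rw [← map_uniformIndex]
  exact (Measure.infinitePi_map_pi _ fun _ => measurable_of_finite (hiddenExample s r)).symm

lemma continuous_risk_hardDistribution (T : Finset (Fin d)) (r : Fin d → ℤˣ) :
    Continuous (risk (hardDistribution T r)) := by
  rw [funext (risk_hardDistribution T r)]
  fun_prop

lemma measurableSet_succeeds (A : LAOAlgorithm d Ω) (T : Finset (Fin d)) (r : Fin d → ℤˣ) (ε : ℝ) :
    MeasurableSet {p : Ω × (ℕ → LabeledExample d) | Succeeds A T r ε p.1 p.2} := by
  refine A.measurableSet_returns (B := {w | ‖w‖ ≤ 1 ∧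
    risk (hardDistribution T r) w - risk (hardDistribution T r) (hardRegressor T r) ≤ ε}) ?_
  have := (continuous_risk_hardDistribution T r).measurable
  exact (measurableSet_le measurable_norm measurable_const).inter
    (measurableSet_le (this.sub measurable_const) measurable_const)

open Classical in
lemma successProb_eq_lintegral (hK : 1 ≤ K) (ρ : Measure Ω) [IsProbabilityMeasure ρ]
    (A : LAOAlgorithm d Ω) (ε : ℝ) (s : Fin K ↪ Fin d) (r : Fin d → ℤˣ) :
    A.successProb ρ (hardDistribution (Finset.univ.map s) r)
        (hardRegressor (Finset.univ.map s) r) ε =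
      ∫⁻ p, (if Succeeds A (Finset.univ.map s) r ε p.1 (hiddenSeq s r p.2) then 1 else 0)
        ∂(ρ.prod (Measure.infinitePi fun _ : ℕ => uniformIndex K)) := by
  have hmeas : Measurable (Prod.map (id : Ω → Ω) (hiddenSeq s r)) :=
    measurable_id.prodMap (measurable_hiddenSeq s r)
  have hset := measurableSet_succeeds A (Finset.univ.map s) r ε
  unfold LAOAlgorithm.successProb
  rw [runLaw_hardDistribution hK]
  refine (Measure.map_apply hmeas hset).trans ?_
  rw [← lintegral_indicator_one (hmeas hset)]
  refine lintegral_congr fun p => ?_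
  simp only [Set.indicator_apply]
  rfl

lemma expectedAttributes_eq_lintegral (hK : 1 ≤ K) (ρ : Measure Ω) [IsProbabilityMeasure ρ]
    (A : LAOAlgorithm d Ω) (s : Fin K ↪ Fin d) (r : Fin d → ℤˣ) :
    A.expectedAttributes ρ (hardDistribution (Finset.univ.map s) r) =
      ∫⁻ p, ((A.attributesSeen p.1 (hiddenSeq s r p.2)).encard : ℝ≥0∞)
        ∂(ρ.prod (Measure.infinitePi fun _ : ℕ => uniformIndex K)) := by
  unfold LAOAlgorithm.expectedAttributes
  rw [runLaw_hardDistribution hK, lintegral_map A.measurable_encard_attributesSeen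
    (measurable_id.prodMap (measurable_hiddenSeq s r))]
  rfl

lemma lintegral_sum_sum {α ι κ : Type*} [MeasurableSpace α] [Fintype ι] [Fintype κ]
    (P : Measure α) {f : ι → κ → α → ℝ≥0∞} (hf : ∀ i j, Measurable (f i j)) :
    ∫⁻ p, ∑ i, ∑ j, f i j p ∂P = ∑ i, ∑ j, ∫⁻ p, f i j p ∂P := by
  rw [lintegral_finsetSum _ fun i _ => Finset.measurable_fun_sum _ fun j _ => hf i j]
  exact Finset.sum_congr rfl fun i _ => lintegral_finsetSum _ fun j _ => hf i j

lemma measurable_attributesSeen_hiddenSeq (A : LAOAlgorithm d Ω) (s : Fin K ↪ Fin d)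
    (r : Fin d → ℤˣ) : Measurable fun p : Ω × (ℕ → Fin K) =>
      ((A.attributesSeen p.1 (hiddenSeq s r p.2)).encard : ℝ≥0∞) := by
  have h := A.measurable_encard_attributesSeen.comp
    (measurable_id.prodMap (measurable_hiddenSeq s r))
  simpa only [Function.comp_def, Prod.map_fst, Prod.map_snd, id] using h

lemma sum_successProb_le (hK : 1 ≤ K) (ρ : Measure Ω) [IsProbabilityMeasure ρ]
    (A : LAOAlgorithm d Ω) {ε : ℝ} (h : Informative K ε) :
    ((21 * K * (d + 1 - K) : ℕ) : ℝ≥0∞) * (∑ s : Fin K ↪ Fin d, ∑ r,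
        A.successProb ρ (hardDistribution (Finset.univ.map s) r)
          (hardRegressor (Finset.univ.map s) r) ε) ≤
      ((13 * K * (d + 1 - K) * (d.descFactorial K * 2 ^ d) : ℕ) : ℝ≥0∞) +
        72 * ∑ s : Fin K ↪ Fin d, ∑ r,
          A.expectedAttributes ρ (hardDistribution (Finset.univ.map s) r) := by
  classical
  have := isProbabilityMeasure_uniformIndex hK
  simp only [successProb_eq_lintegral hK, expectedAttributes_eq_lintegral hK]
  have hmeas : ∀ (s : Fin K ↪ Fin d) (r : Fin d → ℤˣ),
      Measurable (Prod.map (id : Ω → Ω) (hiddenSeq s r)) :=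
    fun s r => measurable_id.prodMap (measurable_hiddenSeq s r)
  have hind : ∀ (s : Fin K ↪ Fin d) (r : Fin d → ℤˣ), Measurable fun p : Ω × (ℕ → Fin K) =>
      if Succeeds A (Finset.univ.map s) r ε p.1 (hiddenSeq s r p.2) then (1 : ℝ≥0∞) else 0 :=
    fun s r => Measurable.ite (hmeas s r (measurableSet_succeeds A _ r ε))
      measurable_const measurable_const
  have hatt := fun s r => measurable_attributesSeen_hiddenSeq A (K := K) s r
  rw [← lintegral_sum_sum _ hind, ← lintegral_sum_sum _ hatt,
    ← lintegral_const_mul' _ _ (ENNReal.natCast_ne_top _), ← lintegral_const_mul' 72 _ (by norm_num)]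
  have hpt : ∀ p : Ω × (ℕ → Fin K), _ := fun p => success_le_attributesSeen A p.1 p.2 h
  have hmono := lintegral_mono (μ := ρ.prod (Measure.infinitePi fun _ : ℕ => uniformIndex K)) hpt
  rw [lintegral_add_left measurable_const, lintegral_const, measure_univ, mul_one] at hmono
  exact hmono

/-! ### From injections to sets -/

lemma card_embedding_map_eq {T : Finset (Fin d)} (hT : T.card = K) :
    ({s | Finset.univ.map s = T} : Finset (Fin K ↪ Fin d)).card = K.factorial := by
  have hcard : Fintype.card (Fin K ↪ T) = K.factorial := by
    rw [Fintype.card_embedding_eq, Fintype.card_coe, Fintype.card_fin, hT, Nat.descFactorial_self]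
  rw [← hcard, ← Finset.card_univ]
  symm
  refine Finset.card_bij (fun e _ => e.trans (Function.Embedding.subtype _)) ?_ ?_ ?_
  · intro e _
    rw [Finset.mem_filter]
    refine ⟨Finset.mem_univ _, Finset.eq_of_subset_of_card_le ?_ (by simp [hT])⟩
    intro i hi
    obtain ⟨j, -, rfl⟩ := Finset.mem_map.mp hi
    exact (e j).2
  · intro e _ e' _ h
    ext j
    exact congrArg Fin.val (DFunLike.congr_fun h j)
  · intro s hs
    have hs' := (Finset.mem_filter.mp hs).2
    refine ⟨⟨fun j => ⟨s j, ?_⟩, fun j j' h => s.injective (congrArg Subtype.val h)⟩,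
      Finset.mem_univ _, ?_⟩
    · rw [← hs']; simp
    · ext j; rfl

/-- Each `T` is the image of `K!` injections, so a uniform injection has a uniform image. -/
lemma sum_embedding_eq (f : Finset (Fin d) → ℝ≥0∞) :
    ∑ s : Fin K ↪ Fin d, f (Finset.univ.map s) =
      K.factorial * ∑ T ∈ Finset.powersetCard K Finset.univ, f T := by
  rw [← Finset.sum_fiberwise_of_maps_to' (t := Finset.powersetCard K Finset.univ)
    (g := fun s : Fin K ↪ Fin d => Finset.univ.map s) (fun s _ => by simp), Finset.mul_sum]
  refine Finset.sum_congr rfl fun T hT => ?_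
  rw [Finset.sum_const, card_embedding_map_eq (Finset.mem_powersetCard.mp hT).2, nsmul_eq_mul]

lemma hardAverage_const_le (hK : K ≤ d) {f : Finset (Fin d) → (Fin d → ℤˣ) → ℝ≥0∞} {b : ℝ≥0∞}
    (h : ∀ T r, T.card = K → b ≤ f T r) : b ≤ hardAverage d K f := by
  have hM : (d.choose K * 2 ^ d : ℕ) ≠ 0 := (Nat.mul_pos (Nat.choose_pos hK) (by positivity)).ne'
  unfold hardAverage
  rw [ENNReal.le_div_iff_mul_le (Or.inl (by exact_mod_cast hM))
    (Or.inl (ENNReal.natCast_ne_top _))]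
  calc _ = ∑ T ∈ Finset.powersetCard K (Finset.univ : Finset (Fin d)), ∑ r : Fin d → ℤˣ, b := by
        simp [mul_comm, mul_left_comm]
    _ ≤ _ := Finset.sum_le_sum fun T hT => Finset.sum_le_sum fun r _ =>
        h T r (Finset.mem_powersetCard.mp hT).2

lemma hardAverage_le_const {f : Finset (Fin d) → (Fin d → ℤˣ) → ℝ≥0∞} {b : ℝ≥0∞}
    (h : ∀ T r, T.card = K → f T r ≤ b) : hardAverage d K f ≤ b := by
  unfold hardAverage
  refine ENNReal.div_le_of_le_mul ?_
  calc _ ≤ ∑ T ∈ Finset.powersetCard K (Finset.univ : Finset (Fin d)), ∑ r : Fin d → ℤˣ, b :=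
        Finset.sum_le_sum fun T hT => Finset.sum_le_sum fun r _ =>
          h T r (Finset.mem_powersetCard.mp hT).2
    _ = _ := by simp [mul_comm, mul_left_comm]

lemma exists_hardAverage_le (hK : K ≤ d) (f : Finset (Fin d) → (Fin d → ℤˣ) → ℝ≥0∞) :
    ∃ T r, T.card = K ∧ hardAverage d K f ≤ f T r := by
  obtain ⟨T₀, -, hT₀⟩ := Finset.exists_subset_card_eq
    (show K ≤ (Finset.univ : Finset (Fin d)).card by simpa)
  obtain ⟨p, hp, hmax⟩ := Finset.exists_max_image
    (Finset.powersetCard K (Finset.univ : Finset (Fin d)) ×ˢ (Finset.univ : Finset (Fin d → ℤˣ)))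
    (fun p => f p.1 p.2) ⟨(T₀, 1), by simp [hT₀]⟩
  exact ⟨p.1, p.2, by simpa using hp, hardAverage_le_const fun T r hT =>
    hmax (T, r) (by simp [hT])⟩

lemma hardAverage_mul_le {k : ℝ≥0∞} {f g : Finset (Fin d) → (Fin d → ℤˣ) → ℝ≥0∞}
    (h : ∀ T r, f T r ≤ k * g T r) : hardAverage d K f ≤ k * hardAverage d K g := by
  unfold hardAverage
  rw [← mul_div_assoc]
  gcongr
  simp only [Finset.mul_sum]
  exact Finset.sum_le_sum fun T _ => Finset.sum_le_sum fun r _ => h T r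

lemma card_mul_dim_le_hardAverage (hK : 1 ≤ K) (hKd : 2 * K ≤ d + 2) (hKd' : K ≤ d)
    (ρ : Measure Ω) [IsProbabilityMeasure ρ] (A : LAOAlgorithm d Ω) {ε : ℝ}
    (h : Informative K ε)
    (hsucc : 2 / 3 ≤ hardAverage d K
      (fun T r => A.successProb ρ (hardDistribution T r) (hardRegressor T r) ε)) :
    ((K * d : ℕ) : ℝ≥0∞) ≤
      144 * hardAverage d K (fun T r => A.expectedAttributes ρ (hardDistribution T r)) := by
  have hM : (d.choose K * 2 ^ d : ℕ) ≠ 0 :=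
    (Nat.mul_pos (Nat.choose_pos hKd') (by positivity)).ne'
  have hmain := sum_successProb_le hK ρ A h
  rw [sum_embedding_eq (fun T => ∑ r, A.successProb ρ (hardDistribution T r)
      (hardRegressor T r) ε),
    sum_embedding_eq (fun T => ∑ r, A.expectedAttributes ρ (hardDistribution T r))] at hmain
  unfold hardAverage at hsucc ⊢
  rw [ENNReal.le_div_iff_mul_le (Or.inl (by exact_mod_cast hM))
    (Or.inl (ENNReal.natCast_ne_top _))] at hsucc
  rw [← mul_div_assoc, ENNReal.le_div_iff_mul_le (Or.inl (by exact_mod_cast hM))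
    (Or.inl (ENNReal.natCast_ne_top _))]
  set S := ∑ T ∈ Finset.powersetCard K (Finset.univ : Finset (Fin d)), ∑ r,
    A.successProb ρ (hardDistribution T r) (hardRegressor T r) ε
  set E := ∑ T ∈ Finset.powersetCard K (Finset.univ : Finset (Fin d)), ∑ r,
    A.expectedAttributes ρ (hardDistribution T r)
  have hfac : ((K.factorial : ℕ) : ℝ≥0∞) ≠ 0 := by exact_mod_cast K.factorial_ne_zero
  have hcancel : ((21 * K * (d + 1 - K) : ℕ) : ℝ≥0∞) * S ≤
      ((13 * K * (d + 1 - K) * (d.choose K * 2 ^ d) : ℕ) : ℝ≥0∞) + 72 * E := by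
    refine (ENNReal.mul_le_mul_iff_right hfac (ENNReal.natCast_ne_top _)).mp ?_
    rw [Nat.descFactorial_eq_factorial_mul_choose] at hmain
    convert hmain using 1
    · ring
    · push_cast; ring
  set M := d.choose K * 2 ^ d
  set X := K * (d + 1 - K) * M with hX
  -- Success probability 2/3 turns 21 into 14, one more than 13; the surplus `X` is what the
  -- attributes must pay for.
  have h14 : ((14 * X : ℕ) : ℝ≥0∞) ≤ ((13 * X : ℕ) : ℝ≥0∞) + 72 * E := by
    refine le_trans ?_ (hcancel.trans (le_of_eq ?_))
    · refine le_trans (le_of_eq ?_) (mul_le_mul_right hsucc _)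
      have h23 : (21 : ℝ≥0∞) * (2 / 3) = 14 := by
        rw [← mul_div_assoc, show (21 * 2 : ℝ≥0∞) = 14 * 3 by norm_num,
          ENNReal.mul_div_cancel_right (by norm_num) (by norm_num)]
      rw [hX]
      push_cast
      calc _ = (21 * (2 / 3) : ℝ≥0∞) * (K * ((d + 1 - K : ℕ) : ℝ≥0∞) * M) := by
            rw [h23]; push_cast; rfl
        _ = _ := by push_cast; ring
    · rw [hX]; congr 2; ring
  have hXE : ((X : ℕ) : ℝ≥0∞) ≤ 72 * E := by
    have : ((14 * X : ℕ) : ℝ≥0∞) = ((13 * X : ℕ) : ℝ≥0∞) + X := by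
      rw [← Nat.cast_add]; congr 1; ring
    rw [this] at h14
    exact (ENNReal.add_le_add_iff_left (ENNReal.natCast_ne_top _)).mp h14
  have hfin : K * d * M ≤ 2 * X := by
    -- This is the role of `2 * K ≤ d + 2`; it doubles 72 to 144.
    have : d ≤ 2 * (d + 1 - K) := by omega
    calc K * d * M ≤ K * (2 * (d + 1 - K)) * M := by gcongr
      _ = 2 * X := by rw [hX]; ring
  calc ((K * d : ℕ) : ℝ≥0∞) * (M : ℕ) = ((K * d * M : ℕ) : ℝ≥0∞) := by push_cast; rfl
    _ ≤ ((2 * X : ℕ) : ℝ≥0∞) := Nat.cast_le.mpr hfin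
    _ = 2 * (X : ℕ) := by push_cast; rfl
    _ ≤ 2 * (72 * E) := by gcongr
    _ = 144 * E := by rw [← mul_assoc]; norm_num

end Averaging

/-! ### Choice of the number of hidden directions -/

lemma exists_informative_card {a : ℝ} (ha : 0 < a) :
    ∃ c : ℝ, 0 < c ∧ ∀ (d : ℕ) (ε : ℝ), 1 ≤ d → a / Real.sqrt d ≤ ε → ε < 1 / 2 →
      ∃ K : ℕ, 1 ≤ K ∧ K ≤ d ∧ 2 * K ≤ d + 2 ∧ Informative K ε ∧
        c / ε ^ 2 ≤ K ∧ (K : ℝ) ≤ 1 / ε ^ 2 := by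
  -- For small `ε`, `K` is the floor of `δ ^ 2 / ε ^ 2`: `δ ≤ 1/8` gives `ε * √K ≤ 1/8`, and `δ ≤
  -- a/2` with `a ^ 2 ≤ ε ^ 2 * d` gives `4 * K ≤ d`.
  set δ : ℝ := min (1 / 8) (a / 2) with hδ
  have hδ0 : 0 < δ := by rw [hδ]; positivity
  have hδ1 : δ ≤ 1 / 8 := min_le_left _ _
  have hδ2 : δ ≤ a / 2 := min_le_right _ _
  refine ⟨δ ^ 2 / 16, by positivity, fun d ε hd hεa hε => ?_⟩
  have hd' : (1 : ℝ) ≤ d := by exact_mod_cast hd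
  have hsd : 0 < Real.sqrt d := Real.sqrt_pos.mpr (by linarith)
  have hε0 : 0 < ε := lt_of_lt_of_le (by positivity) hεa
  have hε2 : 0 < ε ^ 2 := by positivity
  -- Below `δ / 4` the floor is at least 16; above it `1 / ε ^ 2` is bounded and `K = 1` suffices.
  by_cases hcase : δ / 4 < ε
  · refine ⟨1, le_rfl, hd, by omega, Or.inl ⟨rfl, hε⟩, ?_, ?_⟩
    · rw [div_le_iff₀ hε2]; push_cast; nlinarith
    · rw [le_div_iff₀ hε2]; push_cast; nlinarith
  · rw [not_lt] at hcase
    have hx : 16 ≤ δ ^ 2 / ε ^ 2 := by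
      rw [le_div_iff₀ hε2]; nlinarith
    set K := ⌊δ ^ 2 / ε ^ 2⌋₊ with hKdef
    have hK16 : 16 ≤ K := Nat.le_floor (by exact_mod_cast hx)
    have hKle : (K : ℝ) ≤ δ ^ 2 / ε ^ 2 := Nat.floor_le (by positivity)
    have hKge : δ ^ 2 / ε ^ 2 < K + 1 := Nat.lt_floor_add_one _
    have hKε : (K : ℝ) * ε ^ 2 ≤ δ ^ 2 := (le_div_iff₀ hε2).mp hKle
    have had : a ^ 2 ≤ ε ^ 2 * d := by
      have h1 := (div_le_iff₀ hsd).mp hεa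
      have h2 := pow_le_pow_left₀ ha.le h1 2
      rwa [mul_pow, Real.sq_sqrt (by linarith)] at h2
    have hKd : (4 * K : ℝ) ≤ d := by
      have : ε ^ 2 * (4 * K) ≤ ε ^ 2 * d := by nlinarith
      exact le_of_mul_le_mul_left this hε2
    have hKd' : 4 * K ≤ d := by exact_mod_cast hKd
    refine ⟨K, by omega, by omega, by omega, Or.inr ⟨hK16, ?_⟩, ?_, ?_⟩
    · refine le_trans ?_ hδ1
      refine abs_le_of_sq_le_sq' ?_ hδ0.le |>.2
      rw [mul_pow, Real.sq_sqrt (Nat.cast_nonneg K)]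
      linarith
    · have : δ ^ 2 / 16 / ε ^ 2 = (δ ^ 2 / ε ^ 2) / 16 := by ring
      rw [this]
      linarith
    · rw [le_div_iff₀ hε2]
      nlinarith

lemma ofReal_attribute_bound {c ε : ℝ} {d K : ℕ} {E : ℝ≥0∞} (hc : c / ε ^ 2 ≤ K)
    (h : ((K * d : ℕ) : ℝ≥0∞) ≤ 144 * E) :
    ENNReal.ofReal (c / 144 * (d / ε ^ 2)) ≤ E := by
  refine (ENNReal.mul_le_mul_iff_right (a := 144) (by norm_num) (by norm_num)).mp (le_trans ?_ h)
  rw [show (144 : ℝ≥0∞) = ENNReal.ofReal 144 by norm_num, ← ENNReal.ofReal_mul (by norm_num),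
    ← ENNReal.ofReal_natCast]
  refine ENNReal.ofReal_le_ofReal ?_
  have := mul_le_mul_of_nonneg_right hc (Nat.cast_nonneg d : (0 : ℝ) ≤ d)
  calc 144 * (c / 144 * (d / ε ^ 2)) = c / ε ^ 2 * d := by ring
    _ ≤ _ := by push_cast; exact this

lemma ofReal_example_bound {c ε : ℝ} {d k : ℕ} {E F : ℝ≥0∞} (hk : 1 ≤ k)
    (h : ENNReal.ofReal (c * (d / ε ^ 2)) ≤ E) (hEF : E ≤ k * F) :
    ENNReal.ofReal (c * (d / (k * ε ^ 2))) ≤ F := by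
  have hk0 : (k : ℝ) ≠ 0 := by positivity
  have hk1 : (k : ℝ≥0∞) ≠ 0 := by simp; omega
  refine (ENNReal.mul_le_mul_iff_right hk1 (ENNReal.natCast_ne_top k)).mp
    (le_trans (le_of_eq ?_) (h.trans hEF))
  rw [← ENNReal.ofReal_natCast, ← ENNReal.ofReal_mul (Nat.cast_nonneg k)]
  congr 1
  field_simp

/-! ### The lower bound -/

theorem theorem2 (a : ℝ) (ha : 0 < a) :
    ∃ c : ℝ, 0 < c ∧
      ∀ (d k : ℕ) (ε : ℝ), 1 ≤ d → 1 ≤ k → a / Real.sqrt d ≤ ε → ε < 1 / 2 →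
        ∃ K : ℕ, 1 ≤ K ∧ K ≤ d ∧ c / ε ^ 2 ≤ K ∧ (K : ℝ) ≤ 1 / ε ^ 2 ∧
          ∀ (Ω : Type*) [MeasurableSpace Ω] (ρ : Measure Ω) [IsProbabilityMeasure ρ]
            (A : LAOAlgorithm d Ω), A.AttributeBudget k →
            -- for every algorithm some distribution and best regressor are hard
            (∃ (D : Measure (LabeledExample d)) (wstar : EuclideanSpace ℝ (Fin d)),
              (∃ (T : Finset (Fin d)) (r : Fin d → ℤˣ), T.card = K ∧
                D = hardDistribution T r ∧ wstar = hardRegressor T r) ∧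
              IsProbabilityMeasure D ∧
              (∀ᵐ z ∂D, ‖z.1‖ ≤ 1 ∧ z.2 = 1) ∧
              ‖wstar‖ ≤ 1 ∧
              (∀ u : EuclideanSpace ℝ (Fin d), ‖u‖ ≤ 1 → risk D wstar ≤ risk D u) ∧
              (2 / 3 ≤ A.successProb ρ D wstar ε →
                ENNReal.ofReal (c * (d / ε ^ 2)) ≤ A.expectedAttributes ρ D ∧
                ENNReal.ofReal (c * (d / (k * ε ^ 2))) ≤ A.expectedExamples ρ D)) ∧
            -- and the hidden random instance is hard on average
            (2 / 3 ≤ hardAverage d K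
                (fun T r => A.successProb ρ (hardDistribution T r) (hardRegressor T r) ε) →
              ENNReal.ofReal (c * (d / ε ^ 2)) ≤
                hardAverage d K (fun T r => A.expectedAttributes ρ (hardDistribution T r)) ∧
              ENNReal.ofReal (c * (d / (k * ε ^ 2))) ≤
                hardAverage d K (fun T r => A.expectedExamples ρ (hardDistribution T r))) := by
  obtain ⟨c, hc, hcK⟩ := exists_informative_card ha
  refine ⟨c / 144, by positivity, fun d k ε hd hk hεa hε => ?_⟩
  obtain ⟨K, hK1, hKd, hKd2, hinf, hKc, hKε⟩ := hcK d ε hd hεa hε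
  refine ⟨K, hK1, hKd, le_trans ?_ hKc, hKε, fun Ω _ ρ _ A hA => ?_⟩
  · gcongr; linarith
  have havg : 2 / 3 ≤ hardAverage d K
      (fun T r => A.successProb ρ (hardDistribution T r) (hardRegressor T r) ε) →
      ENNReal.ofReal (c / 144 * (d / ε ^ 2)) ≤
        hardAverage d K (fun T r => A.expectedAttributes ρ (hardDistribution T r)) := fun h =>
    ofReal_attribute_bound hKc (card_mul_dim_le_hardAverage hK1 hKd2 hKd ρ A hinf h)
  refine ⟨?_, fun h => ⟨havg h, ofReal_example_bound hk (havg h)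
    (hardAverage_mul_le fun T r => A.expectedAttributes_le hk hA ρ _)⟩⟩
  suffices hex : ∃ (T : Finset (Fin d)) (r : Fin d → ℤˣ), T.card = K ∧
      (2 / 3 ≤ A.successProb ρ (hardDistribution T r) (hardRegressor T r) ε →
        ENNReal.ofReal (c / 144 * (d / ε ^ 2)) ≤
          A.expectedAttributes ρ (hardDistribution T r)) by
    obtain ⟨T, r, hT, hbound⟩ := hex
    have hne : T.Nonempty := Finset.card_pos.mp (by omega)
    exact ⟨_, _, ⟨T, r, hT, rfl, rfl⟩, isProbabilityMeasure_hardDistribution hne r,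
      ae_hardDistribution T r, norm_hardRegressor_le T r,
      fun u hu => risk_hardRegressor_le hne r hu, fun h => ⟨hbound h,
        ofReal_example_bound hk (hbound h) (A.expectedAttributes_le hk hA ρ _)⟩⟩
  -- If all instances are learned, the averaged bound applies and some instance costs at least the
  -- average. Otherwise an instance that is not learned satisfies the implication vacuously.
  by_cases hall : ∀ (T : Finset (Fin d)) (r : Fin d → ℤˣ), T.card = K →
      2 / 3 ≤ A.successProb ρ (hardDistribution T r) (hardRegressor T r) ε
  · obtain ⟨T, r, hT, hle⟩ := exists_hardAverage_le hKd
      (fun T r => A.expectedAttributes ρ (hardDistribution T r))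
    exact ⟨T, r, hT, fun _ => (havg (hardAverage_const_le hKd hall)).trans hle⟩
  · push Not at hall
    obtain ⟨T, r, hT, hlt⟩ := hall
    exact ⟨T, r, hT, fun h => absurd h (not_le.mpr hlt)⟩
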